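/- Let $A$ and $B$ be (not necessarily unital) $C^*$-algebras and let $\varphi\colon A\to B$ be a bounded linear map such that, for all $a,b\in A$, - $a^*b=0$ implies $\varphi(a)^*\varphi(b)=0$ ($\varphi$ preserves range-orthogonality), - $ab^*=0$ implies $\varphi(a)\varphi(b)^*=0$ ($\varphi$ preserves domain-orthogonality), - $ab=0$ implies $\varphi(a)\varphi(b)=0$ ($\varphi$ preserves zero-products). For $n\ge 1$ let $\varphi^{(n)}\colon M_n(A)\to M_n(B)$ be the map that applies $\varphi$ to every entry, where $M_n(A)$ and $M_n(B)$ carry their $C^*$-norms, and put $\|\varphi\|_{cb}:=\sup_{n\ge 1}\|\varphi^{(n)}\|$. Let $\varphi^{**}\colon A^{**}\to B^{**}$ be the bitranspose of $\varphi$, and let $1$ be the (unique) unit of the bidual $A^{**}$ with its usual (Arens) multiplication. Then $\varphi$ is completely bounded, that is, $\|\varphi\|_{cb}<\infty$, and $$\|\varphi\|_{cb}=\|\varphi\|=\|\varphi^{**}(1)\|.$$ -/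

import Mathlib

/-- `φ` preserves zero-products: `a b = 0` implies `φ(a) φ(b) = 0`. -/
def PreservesZeroProducts {A B : Type*} [NonUnitalCStarAlgebra A] [NonUnitalCStarAlgebra B]
    (φ : A → B) : Prop :=
  ∀ a b : A, a * b = 0 → φ a * φ b = 0

/-- `φ` preserves range-orthogonality: `a* b = 0` implies `φ(a)* φ(b) = 0`. -/
def PreservesRangeOrthogonality {A B : Type*} [NonUnitalCStarAlgebra A] [NonUnitalCStarAlgebra B]
    (φ : A → B) : Prop :=
  ∀ a b : A, star a * b = 0 → star (φ a) * φ b = 0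

/-- `φ` preserves domain-orthogonality: `a b* = 0` implies `φ(a) φ(b)* = 0`. -/
def PreservesDomainOrthogonality {A B : Type*} [NonUnitalCStarAlgebra A] [NonUnitalCStarAlgebra B]
    (φ : A → B) : Prop :=
  ∀ a b : A, a * star b = 0 → φ a * star (φ b) = 0

/-- The bidual `A**` of a C⋆-algebra, with the bidual norm. -/
abbrev Bidual (A : Type*) [NonUnitalCStarAlgebra A] : Type _ :=
  StrongDual ℂ (StrongDual ℂ A)

/-- The bitranspose `φ** : A** → B**`, the transpose of the transpose of `φ`. -/
noncomputable def bitranspose {A B : Type*} [NonUnitalCStarAlgebra A] [NonUnitalCStarAlgebra B]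
    (φ : A →L[ℂ] B) : Bidual A →L[ℂ] Bidual B :=
  ContinuousLinearMap.precomp ℂ (ContinuousLinearMap.precomp ℂ φ)

theorem bitranspose_apply {A B : Type*} [NonUnitalCStarAlgebra A] [NonUnitalCStarAlgebra B]
    (φ : A →L[ℂ] B) (F : Bidual A) (f : StrongDual ℂ B) :
    bitranspose φ F f = F (f ∘L φ) := rfl

/-- The right action of `A` on `A*`: the functional `f · a` is `b ↦ f (a b)`. -/
noncomputable def dualAct (A : Type*) [NonUnitalCStarAlgebra A] :
    StrongDual ℂ A →L[ℂ] A →L[ℂ] StrongDual ℂ A :=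
  (ContinuousLinearMap.compL ℂ A (A →L[ℂ] A) (StrongDual ℂ A)).flip (ContinuousLinearMap.mul ℂ A)
    ∘L ContinuousLinearMap.compL ℂ A A ℂ

theorem dualAct_apply {A : Type*} [NonUnitalCStarAlgebra A] (f : StrongDual ℂ A) (a b : A) :
    dualAct A f a b = f (a * b) := rfl

/-- The (first) Arens product on `A**`, that is, the multiplication of the C⋆-algebra `A**`
extending that of `A`:
`(F G)(f) = F (a ↦ G (f · a))`, where `f · a` is the functional `b ↦ f (a b)`. -/
noncomputable def arensMul {A : Type*} [NonUnitalCStarAlgebra A] (F G : Bidual A) : Bidual A :=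
  F ∘L ContinuousLinearMap.compL ℂ A (StrongDual ℂ A) ℂ G ∘L dualAct A

theorem arensMul_apply {A : Type*} [NonUnitalCStarAlgebra A] (F G : Bidual A)
    (f : StrongDual ℂ A) : arensMul F G f = F (G ∘L dualAct A f) := rfl

/-- `e` is the unit `1` of the algebra `A**`. -/
def IsBidualOne {A : Type*} [NonUnitalCStarAlgebra A] (e : Bidual A) : Prop :=
  ∀ F : Bidual A, arensMul e F = F ∧ arensMul F e = F

/-- The amplification `φ⁽ⁿ⁾ : M_n(A) → M_n(B)`, which applies `φ` to every entry. The type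
`CStarMatrix (Fin n) (Fin n) A` is `M_n(A)` with its C⋆-norm. -/
noncomputable def amplification {A B : Type*}
    [NonUnitalCStarAlgebra A] [PartialOrder A] [StarOrderedRing A]
    [NonUnitalCStarAlgebra B] [PartialOrder B] [StarOrderedRing B]
    (φ : A →L[ℂ] B) (n : ℕ) :
    CStarMatrix (Fin n) (Fin n) A →L[ℂ] CStarMatrix (Fin n) (Fin n) B where
  toLinearMap := CStarMatrix.mapₗ φ.toLinearMap
  cont := continuous_pi fun i => continuous_pi fun j =>
    φ.continuous.comp ((continuous_apply j).comp (continuous_apply i))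

theorem amplification_apply {A B : Type*}
    [NonUnitalCStarAlgebra A] [PartialOrder A] [StarOrderedRing A]
    [NonUnitalCStarAlgebra B] [PartialOrder B] [StarOrderedRing B]
    (φ : A →L[ℂ] B) (n : ℕ) (M : CStarMatrix (Fin n) (Fin n) A) (i j : Fin n) :
    amplification φ n M i j = φ (M i j) := rfl

/-- `φ` is completely bounded: the operator norms of its amplifications are bounded. -/
def IsCompletelyBounded {A B : Type*}
    [NonUnitalCStarAlgebra A] [PartialOrder A] [StarOrderedRing A]
    [NonUnitalCStarAlgebra B] [PartialOrder B] [StarOrderedRing B]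
    (φ : A →L[ℂ] B) : Prop :=
  BddAbove (Set.range fun n : ℕ => ‖amplification φ n‖)

/-- The completely bounded norm `‖φ‖_cb = sup_n ‖φ⁽ⁿ⁾‖`, where `n = 0` contributes `0`. It is used
for completely bounded `φ` only. -/
noncomputable def cbNorm {A B : Type*}
    [NonUnitalCStarAlgebra A] [PartialOrder A] [StarOrderedRing A]
    [NonUnitalCStarAlgebra B] [PartialOrder B] [StarOrderedRing B]
    (φ : A →L[ℂ] B) : ℝ :=
  ⨆ n : ℕ, ‖amplification φ n‖

/-!
Range-orthogonality makes `(a, b) ↦ φ(a)* φ(b)` balanced over the multiplier algebra,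
`φ(m* a)* φ(c) = φ(a)* φ(m c)`: for self-adjoint `m` the form `(f, g) ↦ φ(f(m) a)* φ(g(m) c)` on
`C(σ(m), ℝ)` is bounded and local, and such a form satisfies `F(τ, 1) = F(1, τ)`. Hence
`φ(b* a)* φ(u) = φ(a)* φ(b u)` tends to `φ(a)* φ(b)` along an approximate unit, and by matrix
multiplication `φ⁽ⁿ⁾(x* x)* diag(φ(u), …, φ(u))` tends to `φ⁽ⁿ⁾(x)* φ⁽ⁿ⁾(x)`. Since `u` tends weak-*
to the unit of `A**`, this yields `‖φ⁽ⁿ⁾(x)‖² ≤ ‖φ⁽ⁿ⁾(x* x)‖ ‖φ**(1)‖`, so that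
`‖φ⁽ⁿ⁾‖ ≤ ‖φ**(1)‖ ≤ ‖φ‖ ≤ ‖φ⁽¹⁾‖`.

A weak-* limit of an increasing approximate unit is a left unit for the Arens product because
`f · u → f` in norm, which follows from the inequality `‖f · u‖² + ‖f - f · u‖² ≤ ‖f‖²` for
`0 ≤ u ≤ 1`.
-/

open Filter Topology
open scoped MultiplierAlgebra

/-- A bilinear form on continuous functions is local if it vanishes on pairs of functions with
disjoint cozero sets, which is encoded by their product being zero. -/
def IsLocalForm {X E : Type*} [TopologicalSpace X] [AddCommGroup E] [Module ℝ E]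
    (F : C(X, ℝ) →ₗ[ℝ] C(X, ℝ) →ₗ[ℝ] E) : Prop :=
  ∀ f g, f * g = 0 → F f g = 0

namespace IsLocalForm

variable {X E : Type*} [TopologicalSpace X]

section Module

variable [AddCommGroup E] [Module ℝ E] {F : C(X, ℝ) →ₗ[ℝ] C(X, ℝ) →ₗ[ℝ] E}

theorem apply_eq_smul_apply_one (hF : IsLocalForm F) {s f : C(X, ℝ)} {c : ℝ}
    (hf : ∀ x, s x = 0 ∨ f x = c) : F s f = c • F s 1 := by
  rw [← map_smul, ← sub_eq_zero, ← map_sub]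
  refine hF _ _ (ContinuousMap.ext fun x => mul_eq_zero.2 ((hf x).imp_right fun hx => ?_))
  simp [hx]

theorem exists_apply_eq_apply_inf_one (hF : IsLocalForm F) (hAlt : F.IsAlt)
    {τ : C(X, ℝ)} (hτ : 0 ≤ τ) (n : ℕ) :
    ∃ (f g : C(X, ℝ)) (c d : ℝ), c ^ 2 + d ^ 2 = 1 ∧ (∀ x, f x ^ 2 + g x ^ 2 ≤ 1) ∧
      (∀ x, n < τ x → f x = c ∧ g x = d) ∧ F f g = F (τ ⊓ n) 1 := by
  induction n with
  | zero =>
    refine ⟨0, 1, 0, 1, by simp, by simp, by simp, ?_⟩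
    rw [Nat.cast_zero, inf_eq_right.2 hτ, map_zero]
  | succ n ih =>
    obtain ⟨f, g, c, d, hcd, hfg, hconst, hF_eq⟩ := ih
    set s : C(X, ℝ) := τ ⊓ (n + 1 : ℕ) - τ ⊓ n with hs
    have s_apply (x : X) : s x = min (τ x) (n + 1) - min (τ x) n := by simp [hs]
    have s_eq_zero_or (x : X) : s x = 0 ∨ f x = c ∧ g x = d :=
      (le_or_gt (τ x) n).imp (fun hx => by grind) (hconst x)
    have hsf : F s f = c • F s 1 :=
      hF.apply_eq_smul_apply_one fun x => (s_eq_zero_or x).imp_right And.left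
    have hsg : F s g = d • F s 1 :=
      hF.apply_eq_smul_apply_one fun x => (s_eq_zero_or x).imp_right And.right
    -- Between the levels `n` and `n + 1` of `τ` the pair moves along the segment from `(c, d)` to
    -- `(d, -c)`, which adds `(c ^ 2 + d ^ 2) • F s 1` to the value of the form.
    refine ⟨f + (d - c) • s, g + (-c - d) • s, d, -c, by linarith, fun x => ?_, fun x hx => ?_, ?_⟩
    · simp only [ContinuousMap.add_apply, ContinuousMap.smul_apply, smul_eq_mul]
      rcases s_eq_zero_or x with hx | ⟨hfx, hgx⟩
      · simpa [hx] using hfg x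
      · have hs0 : 0 ≤ s x := by grind
        have hs1 : s x ≤ 1 := by grind
        calc (f x + (d - c) * s x) ^ 2 + (g x + (-c - d) * s x) ^ 2
            = (c ^ 2 + d ^ 2) * (1 - 2 * (s x * (1 - s x))) := by rw [hfx, hgx]; ring
          _ ≤ 1 := by rw [hcd]; linarith [mul_nonneg hs0 (sub_nonneg.2 hs1)]
    · push_cast at hx
      have hsx : s x = 1 := by grind
      simp [hsx, hconst x (by linarith)]
    · have hsplit : F (τ ⊓ (n + 1 : ℕ)) 1 = F f g + F s 1 := by
        rw [hF_eq, ← LinearMap.add_apply, ← map_add, hs, add_sub_cancel]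
      simp only [hsplit, map_add, LinearMap.add_apply, map_smul, LinearMap.smul_apply,
        hAlt.self_eq_zero, ← hAlt.neg s f, hsf, hsg]
      match_scalars
      · simp
      · linear_combination hcd

end Module

variable [CompactSpace X] [NormedAddCommGroup E] [NormedSpace ℝ E]
  {F : C(X, ℝ) →ₗ[ℝ] C(X, ℝ) →ₗ[ℝ] E} {K : ℝ}

theorem norm_apply_one_le (hF : IsLocalForm F) (hAlt : F.IsAlt)
    (hbound : ∀ f g, ‖F f g‖ ≤ K * ‖f‖ * ‖g‖) {τ : C(X, ℝ)} (hτ : 0 ≤ τ) : ‖F τ 1‖ ≤ |K| := by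
  obtain ⟨n, hn⟩ := exists_nat_ge ‖τ‖
  obtain ⟨f, g, -, -, -, hfg, -, hF_eq⟩ := hF.exists_apply_eq_apply_inf_one hAlt hτ n
  have hτn : τ ⊓ n = τ := inf_eq_left.2 fun x =>
    (le_abs_self _).trans ((τ.norm_coe_le_norm x).trans hn)
  have hf : ‖f‖ ≤ 1 := (ContinuousMap.norm_le _ zero_le_one).2 fun x =>
    abs_le_one_iff_mul_self_le_one.2 (by nlinarith [hfg x])
  have hg : ‖g‖ ≤ 1 := (ContinuousMap.norm_le _ zero_le_one).2 fun x =>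
    abs_le_one_iff_mul_self_le_one.2 (by nlinarith [hfg x])
  calc ‖F τ 1‖ = ‖F f g‖ := by rw [hF_eq, hτn]
    _ ≤ K * ‖f‖ * ‖g‖ := hbound f g
    _ ≤ |K| * 1 * 1 := by gcongr; exact le_abs_self K
    _ = |K| := by ring

theorem apply_one_eq_zero (hF : IsLocalForm F) (hAlt : F.IsAlt)
    (hbound : ∀ f g, ‖F f g‖ ≤ K * ‖f‖ * ‖g‖) (τ : C(X, ℝ)) : F τ 1 = 0 := by
  have of_nonneg {σ : C(X, ℝ)} (hσ : 0 ≤ σ) : F σ 1 = 0 := by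
    by_contra hne
    obtain ⟨n, hn⟩ := exists_lt_nsmul (norm_pos_iff.2 hne) |K|
    have hle : ‖F (n • σ) 1‖ ≤ |K| := hF.norm_apply_one_le hAlt hbound (nsmul_nonneg hσ n)
    rw [map_nsmul, LinearMap.smul_apply, RCLike.norm_nsmul ℝ] at hle
    exact hle.not_gt hn
  have hτ : 0 ≤ τ + ‖τ‖ • 1 := fun x => by
    simpa [neg_le_iff_add_nonneg] using (abs_le.1 (τ.norm_coe_le_norm x)).1
  simpa [hAlt.self_eq_zero] using of_nonneg hτ

theorem apply_one_right_eq_apply_one_left (hF : IsLocalForm F)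
    (hbound : ∀ f g, ‖F f g‖ ≤ K * ‖f‖ * ‖g‖) (τ : C(X, ℝ)) : F τ 1 = F 1 τ := by
  have hlocal : IsLocalForm (F - F.flip) := fun f g hfg => by
    simp [hF f g hfg, hF g f (by rwa [mul_comm])]
  have hAlt : (F - F.flip).IsAlt := fun f => by simp
  refine sub_eq_zero.1 (hlocal.apply_one_eq_zero (K := 2 * K) hAlt (fun f g => ?_) τ)
  calc ‖F f g - F g f‖ ≤ ‖F f g‖ + ‖F g f‖ := norm_sub_le _ _
    _ ≤ K * ‖f‖ * ‖g‖ + K * ‖g‖ * ‖f‖ := add_le_add (hbound f g) (hbound g f)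
    _ = 2 * K * ‖f‖ * ‖g‖ := by ring

end IsLocalForm

theorem star_fst_mul {A : Type*} [NonUnitalCStarAlgebra A] (m : 𝓜(ℂ, A)) (a b : A) :
    star (m.fst a) * b = star a * (star m).fst b := by
  rw [← (star m).central, DoubleCentralizer.star_snd, star_star]

namespace PreservesRangeOrthogonality

variable {A B : Type*} [NonUnitalCStarAlgebra A] [NonUnitalCStarAlgebra B] {φ : A →L[ℂ] B}

theorem star_map_fst_mul_map_of_isSelfAdjoint (hφ : PreservesRangeOrthogonality φ) {m : 𝓜(ℂ, A)}
    (hm : IsSelfAdjoint m) (a c : A) :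
    star (φ (m.fst a)) * φ c = star (φ a) * φ (m.fst c) := by
  let L : C(spectrum ℝ m, ℝ) →⋆ₐ[ℝ] 𝓜(ℂ, A) := cfcHom hm
  have norm_le (f) (x : A) : ‖φ ((L f).fst x)‖ ≤ ‖φ‖ * (‖f‖ * ‖x‖) := by
    refine φ.le_opNorm_of_le (((L f).fst.le_opNorm x).trans_eq ?_)
    rw [DoubleCentralizer.norm_fst, norm_cfcHom m f hm]
  let F : C(spectrum ℝ m, ℝ) →ₗ[ℝ] C(spectrum ℝ m, ℝ) →ₗ[ℝ] B :=
    LinearMap.mk₂ ℝ (fun f g => star (φ ((L f).fst a)) * φ ((L g).fst c))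
      (fun _ _ _ => by simp [add_mul])
      (fun r f g => by simp [← Complex.coe_smul, smul_mul_assoc])
      (fun _ _ _ => by simp [mul_add])
      (fun r f g => by simp [← Complex.coe_smul, mul_smul_comm])
  have hbound (f g) : ‖F f g‖ ≤ ‖φ‖ * ‖a‖ * (‖φ‖ * ‖c‖) * ‖f‖ * ‖g‖ :=
    calc ‖F f g‖ ≤ ‖φ ((L f).fst a)‖ * ‖φ ((L g).fst c)‖ :=
          (norm_mul_le _ _).trans_eq (by rw [norm_star])
      _ ≤ (‖φ‖ * (‖f‖ * ‖a‖)) * (‖φ‖ * (‖g‖ * ‖c‖)) := by gcongr <;> apply norm_le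
      _ = _ := by ring
  have hF : IsLocalForm F := fun f g hfg => by
    have hLf : star (L f) = L f := by rw [← map_star, star_trivial]
    have hLfg : L f * L g = 0 := by rw [← map_mul, hfg, map_zero]
    refine hφ _ _ ?_
    rw [star_fst_mul, hLf]
    simpa using congrArg (fun m : 𝓜(ℂ, A) => star a * m.fst c) hLfg
  have key := hF.apply_one_right_eq_apply_one_left hbound ((ContinuousMap.id ℝ).restrict _)
  simpa [F, L, cfcHom_id hm] using key

theorem star_map_star_fst_mul_map (hφ : PreservesRangeOrthogonality φ) (m : 𝓜(ℂ, A)) (a c : A) :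
    star (φ ((star m).fst a)) * φ c = star (φ a) * φ (m.fst c) := by
  have hre := hφ.star_map_fst_mul_map_of_isSelfAdjoint (realPart m).2 a c
  have him := hφ.star_map_fst_mul_map_of_isSelfAdjoint (imaginaryPart m).2 a c
  have hm := realPart_add_I_smul_imaginaryPart m
  have hm_star : star m = (realPart m : 𝓜(ℂ, A)) - Complex.I • (imaginaryPart m : 𝓜(ℂ, A)) := by
    conv_lhs => rw [← hm]
    simp [sub_eq_add_neg]
  rw [hm_star]
  conv_rhs => rw [← hm]
  simp [add_mul, mul_add, smul_mul_assoc, mul_smul_comm, hre, him]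

theorem star_map_star_mul_mul_map (hφ : PreservesRangeOrthogonality φ) (a b c : A) :
    star (φ (star b * a)) * φ c = star (φ a) * φ (b * c) := by
  simpa using hφ.star_map_star_fst_mul_map (b : 𝓜(ℂ, A)) a c

end PreservesRangeOrthogonality

section SquaredOpNorm

variable {𝕜 E D : Type*} [RCLike 𝕜] [SeminormedAddCommGroup E] [NormedSpace 𝕜 E]
  [SeminormedAddCommGroup D] [NormedSpace 𝕜 D]

theorem sq_opNorm_le_of_forall_norm_le_one {T : E →L[𝕜] D} {C : ℝ}
    (hT : ∀ x, ‖x‖ ≤ 1 → ‖T x‖ ^ 2 ≤ C) : ‖T‖ ^ 2 ≤ C := by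
  have hC : 0 ≤ C := (sq_nonneg _).trans (hT 0 (by simp))
  rw [← Real.le_sqrt (norm_nonneg _) hC]
  exact T.opNorm_le_of_unit_norm (Real.sqrt_nonneg C) fun x hx => Real.le_sqrt_of_sq_le (hT x hx.le)

end SquaredOpNorm

section BanachAlaoglu

variable {𝕜 E : Type*} [RCLike 𝕜] [NormedAddCommGroup E] [NormedSpace 𝕜 E]

theorem exists_tendsto_bidual {U : Ultrafilter E} {C : ℝ} (hU : ∀ᶠ u in (U : Filter E), ‖u‖ ≤ C) :
    ∃ F : StrongDual 𝕜 (StrongDual 𝕜 E), ‖F‖ ≤ C ∧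
      ∀ f : StrongDual 𝕜 E, Tendsto f U (𝓝 (F f)) := by
  let ι (u : E) : WeakDual 𝕜 (StrongDual 𝕜 E) :=
    StrongDual.toWeakDual (NormedSpace.inclusionInDoubleDual 𝕜 E u)
  have hι : ∀ᶠ u in (U : Filter E), ι u ∈ WeakDual.toStrongDual ⁻¹' Metric.closedBall 0 C := by
    filter_upwards [hU] with u hu
    exact (mem_closedBall_zero_iff (E := StrongDual 𝕜 (StrongDual 𝕜 E))).2
      ((NormedSpace.double_dual_bound 𝕜 E u).trans hu)
  obtain ⟨F, hF, hlim⟩ := (WeakDual.isCompact_closedBall 0 C).ultrafilter_le_nhds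
    (U.map ι) (le_principal_iff.2 hι)
  exact ⟨WeakDual.toStrongDual F, mem_closedBall_zero_iff.1 hF, fun f =>
    ((WeakDual.eval_continuous f).tendsto F).comp hlim⟩

end BanachAlaoglu

section BidualUnit

variable {A : Type*} [NonUnitalCStarAlgebra A]

theorem eq_of_isBidualOne {e e' : Bidual A} (he : IsBidualOne e) (he' : IsBidualOne e') :
    e = e' := by
  rw [← (he' e).2, (he e').1]

variable [PartialOrder A] [StarOrderedRing A]

theorem mul_self_le_self_of_norm_le_one {u : A} (hu : 0 ≤ u) (hu1 : ‖u‖ ≤ 1) : u * u ≤ u := by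
  open Unitization in
  rw [← inr_le_iff _ _ (by rw [IsSelfAdjoint, star_mul, hu.isSelfAdjoint.star_eq])
    hu.isSelfAdjoint, inr_mul]
  have h0 : 0 ≤ (u : Unitization ℂ A) := Unitization.inr_nonneg_iff.2 hu
  have h1 : (u : Unitization ℂ A) ≤ 1 := by
    rwa [← CStarAlgebra.norm_le_one_iff_of_nonneg _, Unitization.norm_inr]
  simpa [sq] using CStarAlgebra.pow_antitone h0 h1 one_le_two

theorem star_mul_self_mul_add_sub_mul_le {u : A} (hu : 0 ≤ u) (hu1 : ‖u‖ ≤ 1) (x w : A) :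
    star (u * x + (w - u * w)) * (u * x + (w - u * w)) ≤ star x * x + star w * w := by
  have hdiff : 0 ≤ star (x - w) * (u - u * u) * (x - w) :=
    star_left_conjugate_nonneg (sub_nonneg.2 (mul_self_le_self_of_norm_le_one hu hu1)) _
  have hx : 0 ≤ star x * x - star x * u * x :=
    sub_nonneg.2 <| (CStarAlgebra.star_left_conjugate_le_norm_smul (a := x) (b := u)).trans <|
      smul_le_of_le_one_left (star_mul_self_nonneg x) hu1
  have hw : 0 ≤ star w * u * w := star_left_conjugate_nonneg hu w
  rw [← sub_nonneg]
  convert add_nonneg (add_nonneg hdiff hx) hw using 1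
  simp only [star_add, star_sub, star_mul, hu.isSelfAdjoint.star_eq]
  noncomm_ring

theorem norm_mul_add_sub_mul_sq_le {u : A} (hu : 0 ≤ u) (hu1 : ‖u‖ ≤ 1) (x w : A) :
    ‖u * x + (w - u * w)‖ ^ 2 ≤ ‖x‖ ^ 2 + ‖w‖ ^ 2 := by
  simp only [sq, ← CStarRing.norm_star_mul_self]
  exact (CStarAlgebra.norm_le_norm_of_nonneg_of_le (star_mul_self_nonneg _)
    (star_mul_self_mul_add_sub_mul_le hu hu1 x w)).trans (norm_add_le _ _)

theorem norm_apply_mul_sq_add_norm_apply_sub_mul_sq_le {u : A} (hu : 0 ≤ u) (hu1 : ‖u‖ ≤ 1)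
    (f : StrongDual ℂ A) {x y : A} (hx : ‖x‖ ≤ 1) (hy : ‖y‖ ≤ 1) :
    ‖f (u * x)‖ ^ 2 + ‖f (y - u * y)‖ ^ 2 ≤ ‖f‖ ^ 2 := by
  set p := f (u * x)
  set q := f (y - u * y)
  set z := u * (star p • x) + (star q • y - u * (star q • y)) with hz
  have hfz : f z = ((‖p‖ ^ 2 + ‖q‖ ^ 2 : ℝ) : ℂ) := by
    simp only [hz, mul_smul_comm, ← smul_sub, map_add, map_smul]
    simp [p, q, ← Complex.conj_mul']
  have hz_le : ‖z‖ ^ 2 ≤ ‖p‖ ^ 2 + ‖q‖ ^ 2 := by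
    refine (norm_mul_add_sub_mul_sq_le hu hu1 _ _).trans ?_
    simp only [norm_smul, norm_star]
    gcongr <;> exact mul_le_of_le_one_right (norm_nonneg _) ‹_›
  have hmul : (‖p‖ ^ 2 + ‖q‖ ^ 2) * (‖p‖ ^ 2 + ‖q‖ ^ 2) ≤ ‖f‖ ^ 2 * (‖p‖ ^ 2 + ‖q‖ ^ 2) :=
    calc (‖p‖ ^ 2 + ‖q‖ ^ 2) * (‖p‖ ^ 2 + ‖q‖ ^ 2) = ‖f z‖ ^ 2 := by
          rw [hfz, Complex.norm_real, Real.norm_eq_abs, sq_abs, sq (_ + _)]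
      _ ≤ (‖f‖ * ‖z‖) ^ 2 := by gcongr; exact f.le_opNorm z
      _ ≤ ‖f‖ ^ 2 * (‖p‖ ^ 2 + ‖q‖ ^ 2) := by rw [mul_pow]; gcongr
  rcases (by positivity : 0 ≤ ‖p‖ ^ 2 + ‖q‖ ^ 2).eq_or_lt with h0 | hpos
  · rw [← h0]
    positivity
  · exact le_of_mul_le_mul_right hmul hpos

theorem norm_dualAct_sq_add_norm_sub_dualAct_sq_le {u : A} (hu : 0 ≤ u) (hu1 : ‖u‖ ≤ 1)
    (f : StrongDual ℂ A) : ‖dualAct A f u‖ ^ 2 + ‖f - dualAct A f u‖ ^ 2 ≤ ‖f‖ ^ 2 := by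
  rw [← le_sub_iff_add_le]
  refine sq_opNorm_le_of_forall_norm_le_one fun x hx => ?_
  rw [le_sub_comm]
  refine sq_opNorm_le_of_forall_norm_le_one fun y hy => ?_
  rw [le_sub_iff_add_le', sub_apply, dualAct_apply, dualAct_apply, ← map_sub]
  exact norm_apply_mul_sq_add_norm_apply_sub_mul_sq_le hu hu1 f hx hy

theorem tendsto_norm_dualAct {l : Filter A} (hl : l.IsIncreasingApproximateUnit)
    (f : StrongDual ℂ A) : Tendsto (fun u => ‖dualAct A f u‖) l (𝓝 ‖f‖) := by
  refine tendsto_order.2 ⟨fun r hr => ?_, fun r hr => ?_⟩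
  · obtain ⟨x, hx, hrx⟩ := f.exists_lt_apply_of_lt_opNorm hr
    have hfx : Tendsto (fun u => ‖f (u * x)‖) l (𝓝 ‖f x‖) :=
      ((f.continuous.tendsto x).comp (hl.tendsto_mul_right x)).norm
    filter_upwards [hfx.eventually (lt_mem_nhds hrx)] with u hu
    exact hu.trans_le ((dualAct A f u).unit_le_opNorm x hx.le)
  · filter_upwards [hl.eventually_nonneg, hl.eventually_norm] with u hu hu1
    refine (le_of_sq_le_sq ?_ (norm_nonneg f)).trans_lt hr
    linarith [norm_dualAct_sq_add_norm_sub_dualAct_sq_le hu hu1 f, sq_nonneg ‖f - dualAct A f u‖]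

theorem tendsto_dualAct {l : Filter A} (hl : l.IsIncreasingApproximateUnit)
    (f : StrongDual ℂ A) : Tendsto (fun u => dualAct A f u) l (𝓝 f) := by
  have hsqrt : Tendsto (fun u => √(‖f‖ ^ 2 - ‖dualAct A f u‖ ^ 2)) l (𝓝 0) := by
    rw [← Real.sqrt_zero, ← sub_self (‖f‖ ^ 2)]
    exact (((tendsto_norm_dualAct hl f).pow 2).const_sub (‖f‖ ^ 2)).sqrt
  refine tendsto_iff_norm_sub_tendsto_zero.2 (squeeze_zero' (.of_forall fun _ => norm_nonneg _)
    ?_ hsqrt)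
  filter_upwards [hl.eventually_nonneg, hl.eventually_norm] with u hu hu1
  rw [norm_sub_rev]
  exact Real.le_sqrt_of_sq_le
    (le_sub_iff_add_le'.2 (norm_dualAct_sq_add_norm_sub_dualAct_sq_le hu hu1 f))

theorem isBidualOne_of_tendsto {l : Filter A} (hl : l.IsIncreasingApproximateUnit)
    {e : Bidual A} (he : ∀ f : StrongDual ℂ A, Tendsto f l (𝓝 (e f))) : IsBidualOne e := by
  have := hl.neBot
  refine fun F => ⟨ContinuousLinearMap.ext fun f => ?_, ContinuousLinearMap.ext fun f => ?_⟩
  · exact tendsto_nhds_unique (he (F ∘L dualAct A f))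
      ((F.continuous.tendsto f).comp (tendsto_dualAct hl f))
  · have hef : e ∘L dualAct A f = f := ContinuousLinearMap.ext fun a =>
      tendsto_nhds_unique (he (dualAct A f a))
        ((f.continuous.tendsto a).comp (hl.tendsto_mul_left a))
    rw [arensMul_apply, hef]

variable (A) in
theorem exists_isIncreasingApproximateUnit_tendsto_bidual :
    ∃ (l : Filter A) (e : Bidual A), l.IsIncreasingApproximateUnit ∧ ‖e‖ ≤ 1 ∧
      ∀ f : StrongDual ℂ A, Tendsto f l (𝓝 (e f)) := by
  have hl := CStarAlgebra.increasingApproximateUnit A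
  have := hl.neBot
  let U := Ultrafilter.of (CStarAlgebra.approximateUnit A)
  have hU : U ≤ CStarAlgebra.approximateUnit A := Ultrafilter.of_le _
  obtain ⟨e, he, hlim⟩ := exists_tendsto_bidual (𝕜 := ℂ) (hU hl.eventually_norm)
  exact ⟨U, e, {
    tendsto_mul_left := fun m => (hl.tendsto_mul_left m).mono_left hU
    tendsto_mul_right := fun m => (hl.tendsto_mul_right m).mono_left hU
    eventually_nonneg := hU hl.eventually_nonneg
    eventually_norm := hU hl.eventually_norm }, he, hlim⟩

end BidualUnit

section Bitranspose

variable {A B : Type*} [NonUnitalCStarAlgebra A] [NonUnitalCStarAlgebra B]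

theorem norm_bitranspose_apply_le (φ : A →L[ℂ] B) (e : Bidual A) :
    ‖bitranspose φ e‖ ≤ ‖φ‖ * ‖e‖ := by
  refine ContinuousLinearMap.opNorm_le_bound _ (by positivity) fun f => ?_
  calc ‖e (f ∘L φ)‖ ≤ ‖e‖ * (‖f‖ * ‖φ‖) := e.le_opNorm_of_le (f.opNorm_comp_le φ)
    _ = ‖φ‖ * ‖e‖ * ‖f‖ := by ring

theorem norm_le_mul_norm_bitranspose_of_tendsto {D : Type*} [NormedAddCommGroup D]
    [NormedSpace ℂ D] {φ : A →L[ℂ] B} {l : Filter A} [l.NeBot] {e : Bidual A}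
    (he : ∀ f : StrongDual ℂ A, Tendsto f l (𝓝 (e f))) {T : B →L[ℂ] D} {d : D}
    (hd : Tendsto (fun u => T (φ u)) l (𝓝 d)) : ‖d‖ ≤ ‖T‖ * ‖bitranspose φ e‖ := by
  obtain ⟨g, hg, hgd⟩ := exists_dual_vector'' ℂ d
  have hlim : bitranspose φ e (g ∘L T) = g d :=
    tendsto_nhds_unique (he ((g ∘L T) ∘L φ)) ((g.continuous.tendsto d).comp hd)
  calc ‖d‖ = ‖bitranspose φ e (g ∘L T)‖ := by simp [hlim, hgd]
    _ ≤ ‖bitranspose φ e‖ * (‖g‖ * ‖T‖) :=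
      (bitranspose φ e).le_opNorm_of_le (g.opNorm_comp_le T)
    _ ≤ ‖bitranspose φ e‖ * (1 * ‖T‖) := by gcongr
    _ = ‖T‖ * ‖bitranspose φ e‖ := by ring

theorem PreservesRangeOrthogonality.tendsto_star_map_mul_map {φ : A →L[ℂ] B}
    (hφ : PreservesRangeOrthogonality φ) {l : Filter A} (hl : l.IsApproximateUnit) (a b : A) :
    Tendsto (fun u => star (φ (star b * a)) * φ u) l (𝓝 (star (φ a) * φ b)) := by
  simp only [hφ.star_map_star_mul_mul_map]
  exact ((φ.continuous.tendsto b).comp (hl.tendsto_mul_left b)).const_mul _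

end Bitranspose

section ScalarMatrix

/-- The embedding of `B` into `M_n(B)` as scalar matrices. -/
def scalarCStarMatrix (n B : Type*) [Fintype n] [DecidableEq n] [NonUnitalCStarAlgebra B] :
    B →⋆ₙₐ[ℂ] CStarMatrix n n B where
  toFun b := CStarMatrix.ofMatrix (Matrix.diagonal fun _ => b)
  map_smul' r b := by ext i j; by_cases h : i = j <;> simp [h]
  map_zero' := by ext i j; simp
  map_add' a b := by ext i j; by_cases h : i = j <;> simp [h]
  map_mul' a b := by
    ext i j
    by_cases h : i = j <;> simp [CStarMatrix.mul_apply, Matrix.diagonal_apply, h]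
  map_star' b := by
    ext i j
    by_cases h : i = j <;> simp [CStarMatrix.star_apply, eq_comm, h]

theorem scalarCStarMatrix_apply {n B : Type*} [Fintype n] [DecidableEq n]
    [NonUnitalCStarAlgebra B] (b : B) (i j : n) :
    scalarCStarMatrix n B b i j = if i = j then b else 0 := rfl

end ScalarMatrix

section Amplification

variable {A B : Type*} [NonUnitalCStarAlgebra A] [PartialOrder A] [StarOrderedRing A]
  [NonUnitalCStarAlgebra B] [PartialOrder B] [StarOrderedRing B] {φ : A →L[ℂ] B}

theorem norm_le_norm_amplification_one (φ : A →L[ℂ] B) : ‖φ‖ ≤ ‖amplification φ 1‖ := by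
  refine φ.opNorm_le_bound (norm_nonneg _) fun a => ?_
  calc ‖φ a‖ = ‖amplification φ 1 (scalarCStarMatrix (Fin 1) A a) 0 0‖ := rfl
    _ ≤ ‖amplification φ 1 (scalarCStarMatrix (Fin 1) A a)‖ := CStarMatrix.norm_entry_le_norm
    _ ≤ ‖amplification φ 1‖ * ‖a‖ := (amplification φ 1).le_opNorm_of_le
      (NonUnitalStarAlgHom.norm_apply_le _ a)

theorem PreservesRangeOrthogonality.tendsto_star_amplification_mul_scalarCStarMatrix
    (hφ : PreservesRangeOrthogonality φ) {l : Filter A} (hl : l.IsApproximateUnit) (n : ℕ)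
    (x y : CStarMatrix (Fin n) (Fin n) A) :
    Tendsto (fun u => star (amplification φ n (star y * x)) * scalarCStarMatrix (Fin n) B (φ u)) l
      (𝓝 (star (amplification φ n x) * amplification φ n y)) := by
  refine tendsto_pi_nhds.2 fun i => tendsto_pi_nhds.2 fun j => ?_
  simpa [CStarMatrix.mul_apply, CStarMatrix.star_apply, amplification_apply,
    scalarCStarMatrix_apply, Finset.sum_mul] using
    tendsto_finsetSum Finset.univ fun k _ => hφ.tendsto_star_map_mul_map hl (x k i) (y k j)

theorem PreservesRangeOrthogonality.norm_amplification_apply_sq_le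
    (hφ : PreservesRangeOrthogonality φ) {l : Filter A} [l.NeBot] (hl : l.IsApproximateUnit)
    {e : Bidual A} (he : ∀ f : StrongDual ℂ A, Tendsto f l (𝓝 (e f))) (n : ℕ)
    (x : CStarMatrix (Fin n) (Fin n) A) :
    ‖amplification φ n x‖ ^ 2 ≤ ‖amplification φ n (star x * x)‖ * ‖bitranspose φ e‖ := by
  set z := star (amplification φ n (star x * x)) with hz
  let T : B →L[ℂ] CStarMatrix (Fin n) (Fin n) B :=
    (LinearMap.mulLeft ℂ z ∘ₗ (scalarCStarMatrix (Fin n) B : B →ₗ[ℂ] _)).mkContinuous ‖z‖ fun b =>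
      (norm_mul_le z _).trans (by gcongr; exact NonUnitalStarAlgHom.norm_apply_le _ b)
  have hT : ‖T‖ ≤ ‖z‖ := LinearMap.mkContinuous_norm_le _ (norm_nonneg z) _
  calc ‖amplification φ n x‖ ^ 2 = ‖star (amplification φ n x) * amplification φ n x‖ := by
        rw [CStarRing.norm_star_mul_self, sq]
    _ ≤ ‖T‖ * ‖bitranspose φ e‖ := norm_le_mul_norm_bitranspose_of_tendsto he
      (hφ.tendsto_star_amplification_mul_scalarCStarMatrix hl n x x)
    _ ≤ ‖z‖ * ‖bitranspose φ e‖ := by gcongr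
    _ = _ := by rw [hz, norm_star]

theorem PreservesRangeOrthogonality.norm_amplification_le_norm_bitranspose
    (hφ : PreservesRangeOrthogonality φ) {l : Filter A} [l.NeBot] (hl : l.IsApproximateUnit)
    {e : Bidual A} (he : ∀ f : StrongDual ℂ A, Tendsto f l (𝓝 (e f))) (n : ℕ) :
    ‖amplification φ n‖ ≤ ‖bitranspose φ e‖ := by
  have hsq : ‖amplification φ n‖ ^ 2 ≤ ‖amplification φ n‖ * ‖bitranspose φ e‖ := by
    refine sq_opNorm_le_of_forall_norm_le_one fun x hx => ?_
    refine (hφ.norm_amplification_apply_sq_le hl he n x).trans ?_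
    gcongr
    refine (amplification φ n).unit_le_opNorm _ ?_
    rw [CStarRing.norm_star_mul_self]
    exact mul_le_one₀ hx (norm_nonneg x) hx
  rcases (norm_nonneg (amplification φ n)).eq_or_lt with h0 | hpos
  · exact h0 ▸ norm_nonneg (bitranspose φ e)
  · exact le_of_mul_le_mul_left (sq ‖amplification φ n‖ ▸ hsq) hpos

end Amplification

theorem proposition4p10_general {A B : Type*}
    [NonUnitalCStarAlgebra A] [PartialOrder A] [StarOrderedRing A]
    [NonUnitalCStarAlgebra B] [PartialOrder B] [StarOrderedRing B]
    (φ : A →L[ℂ] B) (hrange : PreservesRangeOrthogonality φ) :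
    IsCompletelyBounded φ ∧ cbNorm φ = ‖φ‖ ∧
      (∃! e : Bidual A, IsBidualOne e) ∧
      ∀ e : Bidual A, IsBidualOne e → ‖φ‖ = ‖bitranspose φ e‖ := by
  obtain ⟨l, e, hl, he_norm, he⟩ := exists_isIncreasingApproximateUnit_tendsto_bidual A
  have := hl.neBot
  have he_one : IsBidualOne e := isBidualOne_of_tendsto hl he
  have hamp (n : ℕ) : ‖amplification φ n‖ ≤ ‖bitranspose φ e‖ :=
    hrange.norm_amplification_le_norm_bitranspose hl.toIsApproximateUnit he n
  have hφe : ‖bitranspose φ e‖ ≤ ‖φ‖ :=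
    (norm_bitranspose_apply_le φ e).trans (mul_le_of_le_one_right (norm_nonneg φ) he_norm)
  have hφ1 : ‖φ‖ ≤ ‖amplification φ 1‖ := norm_le_norm_amplification_one φ
  have hcb : IsCompletelyBounded φ := ⟨‖φ‖, Set.forall_mem_range.2 fun n => (hamp n).trans hφe⟩
  refine ⟨hcb, le_antisymm (ciSup_le fun n => (hamp n).trans hφe) (hφ1.trans (le_ciSup hcb 1)),
    ⟨e, he_one, fun _ he' => eq_of_isBidualOne he' he_one⟩, fun e' he' => ?_⟩
  rw [eq_of_isBidualOne he' he_one]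
  exact le_antisymm (hφ1.trans (hamp 1)) hφe

/-- The orders on `A` and `B` are the canonical ones of C⋆-algebras (`StarOrderedRing` determines
them); Mathlib's C⋆-norm on matrices asks for them. -/
theorem proposition4p10 {A B : Type*}
    [NonUnitalCStarAlgebra A] [PartialOrder A] [StarOrderedRing A]
    [NonUnitalCStarAlgebra B] [PartialOrder B] [StarOrderedRing B]
    (φ : A →L[ℂ] B)
    (hrange : PreservesRangeOrthogonality φ)
    (hdomain : PreservesDomainOrthogonality φ)
    (hzero : PreservesZeroProducts φ) :
    IsCompletelyBounded φ ∧ cbNorm φ = ‖φ‖ ∧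
      (∃! e : Bidual A, IsBidualOne e) ∧
      ∀ e : Bidual A, IsBidualOne e → ‖φ‖ = ‖bitranspose φ e‖ :=
  proposition4p10_general φ hrange
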